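/- **Theorem (Nash Equilibrium Welfare Approximation).** Consider a Bakers and Millers Game with finite sets $L\neq\emptyset$ of locations, $\mathcal B$ of bakers and $\mathcal M\neq\emptyset$ of millers, where each baker $b$ has a nonempty set $L(b)\subseteq L$ of feasible locations. A strategy profile $(\mathbf s,\mathbf t)$ consists of locations $s_b\in L(b)$ for $b\in\mathcal B$ and $t_m\in L$ for $m\in\mathcal M$. Let $B_{\mathbf s}(\ell)=|\{b: s_b=\ell\}|$ and $M_{\mathbf t}(\ell)=|\{m: t_m=\ell\}|$. The utilities are $u_b(\mathbf s,\mathbf t)=M_{\mathbf t}(s_b)/B_{\mathbf s}(s_b)$ and $u_m(\mathbf s,\mathbf t)=B_{\mathbf s}(t_m)/M_{\mathbf t}(t_m)$. A profile is a pure Nash equilibrium if no baker $b$ can strictly increase $u_b$ by moving alone to another location in $L(b)$ and no miller $m$ can strictly increase $u_m$ by moving alone to another location in $L$. The coverage is $W(\mathbf s,\mathbf t)=|\{b\in\mathcal B: M_{\mathbf t}(s_b)>0\}|$, and the optimal coverage is its maximum over all strategy profiles. Algorithm 1 works as follows. 1. Start with $L'=L$ and $\mathcal B'=\mathcal B$.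 For $i=1,\dots,|L|$, let $\ell_i$ be a location $\ell\in L'$ that maximizes $|\{b\in\mathcal B':\ell\in L(b)\}|$ (ties broken arbitrarily), set $s_b=\ell_i$ for all $b\in\mathcal B'$ with $\ell_i\in L(b)$, and remove $\ell_i$ from $L'$ and these bakers from $\mathcal B'$. 2. Insert the millers one after the other, in an arbitrary order. Each miller $m$ is placed at the location $t^*_m=\ell$ that maximizes $B_{\mathbf s}(\ell)/(M_{\mathbf t}(\ell)+1)$, where $M_{\mathbf t}(\ell)$ counts the millers already placed at $\ell$; among several maximizers, the one with the smallest index in $\ell_1,\dots,\ell_{|L|}$ is taken. 3. Let $\mathbf s^*$ be any baker strategy profile that maximizes $\Phi_{\mathbf t^*}(\mathbf s)=\sum_{\ell\in L}M_{\mathbf t^*}(\ell)\,H_{B_{\mathbf s}(\ell)}$ over all baker strategy profiles $\mathbf s$, where $H_i$ is the $i$-th harmonic number. Output $(\mathbf s^*,\mathbf t^*)$. Then Algorithm 1 has an output, and every output $(\mathbf s^*,\mathbf t^*)$ that it can produce is a pure Nash equilibrium that approximates the optimal coverage within a factor of $\left(1+\frac{\min(|L|,|\mathcal M|)-1}{|\mathcal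 M|}\right)\frac{e}{e-1}$, that is, for every strategy profile $(\mathbf s,\mathbf t)$, $$W(\mathbf s,\mathbf t)\;\le\;\left(1+\frac{\min(|L|,|\mathcal M|)-1}{|\mathcal M|}\right)\frac{e}{e-1}\;W(\mathbf s^*,\mathbf t^*).$$ -/

import Mathlib

namespace BakersMillers

/-- The number of agents that the assignment `f` places at `x`. For a baker profile this is the
number of bakers at a location, for a miller profile the number of millers. While an assignment
is still under construction it has values in `Option Loc` (`none` for agents not yet placed), and
the number of agents at `ℓ` is `load f (some ℓ)`. -/
def load {α β : Type*} [Fintype α] [DecidableEq β] (f : α → β) (x : β) : ℕ :=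
  (Finset.univ.filter fun a => f a = x).card

/-- A Bakers and Millers Game with restricted bakers: every baker has a nonempty set of feasible
locations, every miller may choose any location. -/
structure Game (Loc Baker : Type*) where
  feasible : Baker → Finset Loc
  feasible_nonempty : ∀ b, (feasible b).Nonempty

section

variable {Loc Baker Miller : Type*} [Fintype Loc] [DecidableEq Loc]
  [Fintype Baker] [DecidableEq Baker] [Fintype Miller] [DecidableEq Miller]

/-- The utility of baker `b`: the number of millers divided by the number of bakers at her
location (the denominator is positive, as `b` herself is there). -/
def bakerUtility (s : Baker → Loc) (t : Miller → Loc) (b : Baker) : ℚ :=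
  (load t (s b) : ℚ) / (load s (s b) : ℚ)

/-- The utility of miller `m`: the number of bakers divided by the number of millers at her
location (the denominator is positive, as `m` herself is there). -/
def millerUtility (s : Baker → Loc) (t : Miller → Loc) (m : Miller) : ℚ :=
  (load s (t m) : ℚ) / (load t (t m) : ℚ)

/-- The coverage of a strategy profile: the number of bakers with at least one miller at the same
location. -/
def coverage (s : Baker → Loc) (t : Miller → Loc) : ℕ :=
  (Finset.univ.filter fun b => 0 < load t (s b)).card

/-- Rosenthal's potential of the baker profile `s`, for the miller profile `t`. -/
def potential (t : Miller → Loc) (s : Baker → Loc) : ℚ :=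
  ∑ ℓ : Loc, (load t ℓ : ℚ) * harmonic (load s ℓ)

namespace Game

variable (G : Game Loc Baker)

/-- `s` is a baker strategy profile: each baker is at one of her feasible locations. -/
def IsBakerProfile (s : Baker → Loc) : Prop :=
  ∀ b, s b ∈ G.feasible b

instance (s : Baker → Loc) : Decidable (G.IsBakerProfile s) :=
  inferInstanceAs (Decidable (∀ b, s b ∈ G.feasible b))

/-- No baker can strictly improve by moving to another feasible location. -/
def IsBakerEquilibrium (s : Baker → Loc) (t : Miller → Loc) : Prop :=
  ∀ b, ¬ ∃ ℓ ∈ G.feasible b,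
    bakerUtility s t b < bakerUtility (Function.update s b ℓ) t b

end Game

/-- No miller can strictly improve by moving to another location. -/
def IsMillerEquilibrium (s : Baker → Loc) (t : Miller → Loc) : Prop :=
  ∀ m, ¬ ∃ ℓ : Loc, millerUtility s t m < millerUtility s (Function.update t m ℓ) m

namespace Game

variable (G : Game Loc Baker)

/-- `(s, t)` is a strategy profile that is a pure Nash equilibrium. -/
def IsPureNash (s : Baker → Loc) (t : Miller → Loc) : Prop :=
  G.IsBakerProfile s ∧ G.IsBakerEquilibrium s t ∧ IsMillerEquilibrium s t

/-- The optimal coverage: the maximum of the coverage over all strategy profiles. -/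
def optimalCoverage (Miller : Type*) [Fintype Miller] [DecidableEq Miller] : ℕ :=
  (Finset.univ.filter fun p : (Baker → Loc) × (Miller → Loc) => G.IsBakerProfile p.1).sup
    fun p => coverage p.1 p.2

/-- The bakers of `B'` that have `ℓ` in range. -/
def inRange (B' : Finset Baker) (ℓ : Loc) : Finset Baker :=
  B'.filter fun b => ℓ ∈ G.feasible b

/-- First loop of the algorithm. `Concentrate G L' B' s order s'`: started with the remaining
locations `L'`, the remaining bakers `B'` and the partial baker assignment `s`, the loop can
remove the locations in the order `order` and end with the assignment `s'`. Each iteration picks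
a remaining location `ℓ` with most remaining bakers in range (ties are broken arbitrarily),
assigns those bakers to `ℓ`, and removes `ℓ` and those bakers. -/
inductive Concentrate :
    Finset Loc → Finset Baker → (Baker → Option Loc) → List Loc → (Baker → Option Loc) → Prop
  | done (B' : Finset Baker) (s : Baker → Option Loc) : Concentrate ∅ B' s [] s
  | step (L' : Finset Loc) (B' : Finset Baker) (s : Baker → Option Loc) (ℓ : Loc)
      (order : List Loc) (s' : Baker → Option Loc)
      (mem : ℓ ∈ L')
      (most : ∀ ℓ' ∈ L', (G.inRange B' ℓ').card ≤ (G.inRange B' ℓ).card)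
      (rest : Concentrate (L'.erase ℓ) (B' \ G.inRange B' ℓ)
        (fun b => if b ∈ G.inRange B' ℓ then some ℓ else s b) order s') :
      Concentrate L' B' s (ℓ :: order) s'

end Game

/-- The quotient that an arriving miller maximizes: the bakers at `ℓ` over the millers already
at `ℓ` plus one. -/
def arrivalUtility (s : Baker → Option Loc) (t : Miller → Option Loc) (ℓ : Loc) : ℚ :=
  (load s (some ℓ) : ℚ) / ((load t (some ℓ) : ℚ) + 1)

/-- Second loop of the algorithm. `InsertMillers order s ms t t'`: for the baker assignment `s`,
inserting the millers of the list `ms` one after the other into the partial miller assignment `t`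
ends with the assignment `t'`. Each miller goes to the location that maximizes `arrivalUtility`,
and among several such locations to the one with the smallest index in `order`. -/
inductive InsertMillers (order : List Loc) (s : Baker → Option Loc) :
    List Miller → (Miller → Option Loc) → (Miller → Option Loc) → Prop
  | done (t : Miller → Option Loc) : InsertMillers order s [] t t
  | step (m : Miller) (ms : List Miller) (t t' : Miller → Option Loc) (ℓ : Loc)
      (best : ∀ ℓ', arrivalUtility s t ℓ' ≤ arrivalUtility s t ℓ)
      (first : ∀ ℓ', arrivalUtility s t ℓ' = arrivalUtility s t ℓ →
        order.idxOf ℓ ≤ order.idxOf ℓ')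
      (rest : InsertMillers order s ms (Function.update t m (some ℓ)) t') :
      InsertMillers order s (m :: ms) t t'

namespace Game

variable (G : Game Loc Baker)

/-- `(s, t)` is a possible output of the algorithm: the first loop, started with all locations
and all bakers, yields an order of the locations and a baker assignment `s₀`; the second loop
inserts all millers, each once, in some order, and yields `t`; finally `s` is a baker profile
that maximizes the potential for `t`. -/
def AlgorithmOutput (s : Baker → Loc) (t : Miller → Loc) : Prop :=
  ∃ (order : List Loc) (s₀ : Baker → Option Loc) (millers : List Miller),
    G.Concentrate Finset.univ Finset.univ (fun _ => none) order s₀ ∧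
    millers.Nodup ∧ (∀ m, m ∈ millers) ∧
    InsertMillers order s₀ millers (fun _ => none) (fun m => some (t m)) ∧
    G.IsBakerProfile s ∧
    ∀ s', G.IsBakerProfile s' → potential t s' ≤ potential t s

end Game

end

end BakersMillers

set_option linter.unusedSectionVars false

namespace BakersMillers

section

variable {Loc Baker Miller : Type*} [Fintype Loc] [DecidableEq Loc]
  [Fintype Baker] [DecidableEq Baker] [Fintype Miller]

/-! ### Loads -/

section Load

variable {α β : Type*} [Fintype α] [DecidableEq β]

/-! Let `σ` be the baker profile built by the first loop. Arriving millers apportion themselves as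
in a divisor method, so one ratio `p / q` satisfies `p * M ℓ ≤ q * B ℓ ≤ p * (M ℓ + 1)` at every
location (`IsApportioned.exists_ratio`): staying pays at least `p / q`, arriving elsewhere at most
`p / q`. The tie-breaking makes the number of millers antitone in the order of the locations.

The crux is that replacing `σ` by a potential maximizer `s` preserves these bounds for the same `p`
and `q` (`IsGreedy.mul_load_le`, `IsGreedy.le_mul_load`), so the millers stay in equilibrium. By
maximality, bakers cannot profitably be shifted even along chains of moves
(`Reaches.load_mul_load_le`). A location violating a bound therefore spreads its excess or deficit
over a set of locations linked to it by chains, while `σ`, which prefers locations with more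
millers, forces the opposite inequality between the total loads of that set.

For the coverage put `r = min |L| |M|`. The first `r` greedy locations hold at least a fraction `1 -
1/e` of the bakers any profile covers (`IsGreedy.one_sub_inv_mul_coverage_le`). Those of them
without millers number at most `r - 1` and hold at most `p / q` bakers each, which gives the other
factor (`IsGreedy.mul_card_rank_lt_le`). Finally, `s` covers every baker that `σ` covers
(`card_covered_le_coverage`). -/

theorem load_pos_apply (f : α → β) (a : α) : 0 < load f (f a) :=
  Finset.card_pos.2 ⟨a, by simp⟩

theorem load_some_comp (f : α → β) (x : β) : load (fun a => some (f a)) (some x) = load f x := by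
  simp [load]

theorem sum_load (f : α → β) (A : Finset β) :
    ∑ x ∈ A, load f x = (Finset.univ.filter fun a => f a ∈ A).card := by
  rw [Finset.card_eq_sum_card_fiberwise (f := f) (t := A) (by intro a; simp)]
  refine Finset.sum_congr rfl fun x hx => ?_
  rw [load]
  congr 1
  ext a
  simp only [Finset.mem_filter, Finset.mem_univ, true_and]
  exact ⟨fun h => ⟨h ▸ hx, h⟩, fun h => h.2⟩

theorem sum_load_le (f g : α → β) (A : Finset β) (h : ∀ a, f a ∈ A → g a ∈ A) :
    ∑ x ∈ A, load f x ≤ ∑ x ∈ A, load g x := by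
  rw [sum_load, sum_load]
  refine Finset.card_le_card fun a => ?_
  simpa using h a

/-- Adding the indicators on both sides avoids truncated subtraction and includes the trivial move
`y = f a`. -/
theorem load_update [DecidableEq α] (f : α → β) (a : α) (y x : β) :
    load (Function.update f a y) x + (if x = f a then 1 else 0) =
      load f x + (if x = y then 1 else 0) := by
  have key : ∀ g : α → β, load g x =
      (if g a = x then 1 else 0) + ∑ c ∈ Finset.univ.erase a, if g c = x then 1 else 0 := by
    intro g
    rw [load, Finset.card_filter,
      Finset.add_sum_erase _ (fun c => if g c = x then 1 else 0) (Finset.mem_univ a)]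
  rw [key, key f]
  have h : ∑ c ∈ Finset.univ.erase a, (if Function.update f a y c = x then 1 else 0) =
      ∑ c ∈ Finset.univ.erase a, if f c = x then 1 else 0 := by
    refine Finset.sum_congr rfl fun c hc => ?_
    rw [Function.update_of_ne (Finset.ne_of_mem_erase hc)]
  rw [h, Function.update_self]
  simp only [eq_comm (a := x)]
  omega

end Load

/-! ### Maximizers of the potential -/

namespace Game

variable (G : Game Loc Baker)

/-- `x` can be reached from `y` by successive moves of bakers of the profile `s`. -/
def Reaches (s : Baker → Loc) : Loc → Loc → Prop :=
  Relation.ReflTransGen fun y x => ∃ b, s b = y ∧ x ∈ G.feasible b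

variable {G}

/-- If `x` can be reached from `y`, then some profile has one baker less at `y` and one more
at `x`. -/
theorem Reaches.exists_exchange {s : Baker → Loc} (hs : G.IsBakerProfile s) {y x : Loc}
    (h : G.Reaches s y x) :
    ∃ s', G.IsBakerProfile s' ∧ ∀ z, load s' z + (if z = y then 1 else 0) =
      load s z + (if z = x then 1 else 0) := by
  -- A maximal set with this property is closed under moves. The agreement clause makes extension
  -- possible: bakers at `x` have not moved yet, so one of them can move on to a new location, and
  -- bakers outside `A` are untouched, so the clause survives.
  let P : Finset Loc → Prop := fun A => y ∈ A ∧ ∀ x ∈ A, ∃ s', G.IsBakerProfile s' ∧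
    (∀ z, load s' z + (if z = y then 1 else 0) = load s z + (if z = x then 1 else 0)) ∧
    ∀ b, s b = x ∨ s b ∉ A → s' b = s b
  have hP : P {y} := by
    refine ⟨by simp, fun x hx => ⟨s, hs, ?_, fun _ _ => rfl⟩⟩
    rw [Finset.mem_singleton.1 hx]
    exact fun _ => rfl
  obtain ⟨A, hA⟩ := (Set.toFinite {A | P A}).exists_maximal ⟨_, hP⟩
  obtain ⟨⟨hyA, hex⟩, hmax⟩ := hA
  have closed : ∀ b, s b ∈ A → G.feasible b ⊆ A := by
    intro b hb x' hx'
    by_contra hxA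
    refine hxA (hmax (y := insert x' A) ⟨by simp [hyA], ?_⟩ (Finset.subset_insert _ _)
      (Finset.mem_insert_self _ _))
    intro x hx
    rcases Finset.mem_insert.1 hx with rfl | hx
    · obtain ⟨s', hs', hload, hagree⟩ := hex _ hb
      refine ⟨Function.update s' b x, ?_, ?_, ?_⟩
      · intro c
        by_cases hc : c = b
        · subst hc; simpa using hx'
        · simpa [hc] using hs' c
      · intro z
        have h1 := load_update s' b x z
        have h2 := hload z
        rw [hagree b (Or.inl rfl)] at h1
        omega
      · intro c hc
        have hcA : s c ∉ A := by
          rcases hc with hc | hc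
          · rwa [hc]
          · exact fun h => hc (Finset.mem_insert_of_mem h)
        have hcb : c ≠ b := fun h => hcA (h ▸ hb)
        rw [Function.update_of_ne hcb, hagree c (Or.inr hcA)]
    · obtain ⟨s', hs', hload, hagree⟩ := hex _ hx
      refine ⟨s', hs', hload, fun c hc => hagree c (hc.imp_right fun h h' => h ?_)⟩
      exact Finset.mem_insert_of_mem h'
  have hxA : x ∈ A := by
    induction h with
    | refl => exact hyA
    | tail _ hstep ih =>
      obtain ⟨b, hb, hx⟩ := hstep
      exact closed b (hb ▸ ih) hx
  obtain ⟨s', hs', hload, -⟩ := hex x hxA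
  exact ⟨s', hs', hload⟩

theorem harmonic_exchange {a b : ℕ} {p q : Prop} [Decidable p] [Decidable q]
    (hpq : ¬ (p ∧ q)) (h : a + (if p then 1 else 0) = b + (if q then 1 else 0)) :
    harmonic a = harmonic b + (if q then ((b : ℚ) + 1)⁻¹ else 0) - if p then (b : ℚ)⁻¹ else 0 := by
  by_cases hp : p
  · have hq : ¬ q := fun hq => hpq ⟨hp, hq⟩
    simp only [hp, hq, if_true, if_false, add_zero] at h ⊢
    rw [← h, harmonic_succ]
    push_cast
    ring
  · by_cases hq : q
    · simp only [hp, hq, if_true, if_false, add_zero] at h ⊢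
      rw [h, harmonic_succ]
      push_cast
      ring
    · simp only [hp, hq, if_false, add_zero] at h ⊢
      rw [h]; ring

/-- In a potential maximizer, the share of millers cannot be improved along reachability. -/
theorem Reaches.load_mul_load_le {s : Baker → Loc} (hs : G.IsBakerProfile s) {t : Miller → Loc}
    (hmax : ∀ s', G.IsBakerProfile s' → potential t s' ≤ potential t s) {y x : Loc}
    (h : G.Reaches s y x) :
    load t x * load s y ≤ load t y * (load s x + 1) := by
  by_cases hxy : x = y
  · subst hxy; exact Nat.mul_le_mul_left _ (Nat.le_succ _)
  obtain ⟨s', hs', hload⟩ := h.exists_exchange hs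
  have hy : 0 < load s y := by
    have := hload y
    simp only [if_true, if_neg (Ne.symm hxy)] at this
    omega
  -- Only the loads at `x` and `y` differ, so the potential gains one harmonic term and loses one.
  have hdiff : potential t s' = potential t s + (load t x : ℚ) * ((load s x : ℚ) + 1)⁻¹ -
      (load t y : ℚ) * (load s y : ℚ)⁻¹ := by
    have e : ∀ z, harmonic (load s' z) = harmonic (load s z) +
        (if z = x then ((load s z : ℚ) + 1)⁻¹ else 0) -
          if z = y then (load s z : ℚ)⁻¹ else 0 := fun z =>
      harmonic_exchange (fun hz => hxy (hz.2 ▸ hz.1)) (hload z)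
    simp only [potential, e, mul_add, mul_sub, Finset.sum_add_distrib, Finset.sum_sub_distrib,
      mul_ite, mul_zero, Finset.sum_ite_eq', Finset.mem_univ, if_true]
  have hle := hmax s' hs'
  have hyQ : (0 : ℚ) < load s y := by exact_mod_cast hy
  have hxQ : (0 : ℚ) < (load s x : ℚ) + 1 := by positivity
  have h3 : (load t x : ℚ) / ((load s x : ℚ) + 1) ≤ (load t y : ℚ) / (load s y : ℚ) := by
    rw [div_eq_mul_inv, div_eq_mul_inv]
    linarith
  rw [div_le_div_iff₀ hxQ hyQ] at h3
  exact_mod_cast h3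

theorem isBakerEquilibrium_of_potential_le {s : Baker → Loc} (hs : G.IsBakerProfile s)
    {t : Miller → Loc} (hmax : ∀ s', G.IsBakerProfile s' → potential t s' ≤ potential t s) :
    G.IsBakerEquilibrium s t := by
  rintro b ⟨ℓ, hℓ, hlt⟩
  by_cases hb : ℓ = s b
  · subst hb
    simp at hlt
  refine absurd hlt (not_lt.2 ?_)
  have h1 : G.Reaches s (s b) ℓ := Relation.ReflTransGen.single ⟨b, rfl, hℓ⟩
  have h2 := h1.load_mul_load_le hs hmax
  have h3 := load_update s b ℓ ℓ
  simp only [if_neg hb, if_true, add_zero] at h3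
  have h4 := load_pos_apply s b
  rw [bakerUtility, bakerUtility, Function.update_self, h3,
    div_le_div_iff₀ (by positivity) (by exact_mod_cast h4)]
  exact_mod_cast h2

end Game

/-! ### The first loop -/

namespace Game

/-- The profile `σ` sends each baker to her first feasible location in the injective ranking
`rank`, and each location gets at least as many bakers as any location could get from the bakers
that are not sent to earlier locations. -/
structure IsGreedy (G : Game Loc Baker) (rank : Loc → ℕ) (σ : Baker → Loc) : Prop where
  injective : Function.Injective rank
  exists_rank_eq : ∀ i < Fintype.card Loc, ∃ ℓ, rank ℓ = i
  mem : ∀ b, σ b ∈ G.feasible b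
  le : ∀ b, ∀ x ∈ G.feasible b, rank (σ b) ≤ rank x
  most : ∀ ℓ ℓ', (Finset.univ.filter fun b => ℓ' ∈ G.feasible b ∧ rank ℓ ≤ rank (σ b)).card ≤
    load σ ℓ

variable {G : Game Loc Baker}

theorem Concentrate.apply_of_notMem {L' : Finset Loc} {B' : Finset Baker}
    {s s' : Baker → Option Loc} {order : List Loc} (h : G.Concentrate L' B' s order s') :
    ∀ b ∉ B', s' b = s b := by
  induction h with
  | done => exact fun _ _ => rfl
  | step L' B' s ℓ order s' mem most rest ih =>
    intro b hb
    have h1 : b ∉ G.inRange B' ℓ := fun h => hb (Finset.mem_filter.1 h).1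
    rw [ih b (fun h => hb (Finset.mem_sdiff.1 h).1)]
    exact if_neg h1

theorem Concentrate.nodup_and_mem_iff {L' : Finset Loc} {B' : Finset Baker}
    {s s' : Baker → Option Loc} {order : List Loc} (h : G.Concentrate L' B' s order s') :
    order.Nodup ∧ ∀ ℓ, ℓ ∈ order ↔ ℓ ∈ L' := by
  induction h with
  | done => simp
  | step L' B' s ℓ order s' mem most rest ih =>
    refine ⟨List.nodup_cons.2 ⟨by simp [ih.2], ih.1⟩, fun x => ?_⟩
    rw [List.mem_cons, ih.2, Finset.mem_erase]
    by_cases hx : x = ℓ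
    · simp [hx, mem]
    · simp [hx]

theorem Concentrate.exists_first {L' : Finset Loc} {B' : Finset Baker}
    {s s' : Baker → Option Loc} {order : List Loc} (h : G.Concentrate L' B' s order s')
    (hB : ∀ b ∈ B', G.feasible b ⊆ L') :
    ∀ b ∈ B', ∃ ℓ ∈ G.feasible b, s' b = some ℓ ∧
      ∀ x ∈ G.feasible b, order.idxOf ℓ ≤ order.idxOf x := by
  induction h with
  | done =>
    intro b hb
    obtain ⟨x, hx⟩ := G.feasible_nonempty b
    exact absurd (hB b hb hx) (Finset.notMem_empty x)
  | step L' B' s ℓ order s' mem most rest ih =>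
    intro b hb
    by_cases hℓ : ℓ ∈ G.feasible b
    · have h1 : b ∈ G.inRange B' ℓ := Finset.mem_filter.2 ⟨hb, hℓ⟩
      refine ⟨ℓ, hℓ, ?_, fun x _ => by simp⟩
      rw [rest.apply_of_notMem b (fun h => (Finset.mem_sdiff.1 h).2 h1), if_pos h1]
    · have hne : ∀ x ∈ G.feasible b, ℓ ≠ x := fun x hx h => hℓ (h ▸ hx)
      have h2 : b ∈ B' \ G.inRange B' ℓ :=
        Finset.mem_sdiff.2 ⟨hb, fun h => hℓ (Finset.mem_filter.1 h).2⟩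
      obtain ⟨y, hy, hsy, hfirst⟩ := ih (by
        intro c hc x hx
        obtain ⟨hc1, hc2⟩ := Finset.mem_sdiff.1 hc
        refine Finset.mem_erase.2 ⟨fun h => hc2 (Finset.mem_filter.2 ⟨hc1, h ▸ hx⟩), hB c hc1 hx⟩)
        b h2
      refine ⟨y, hy, hsy, fun x hx => ?_⟩
      rw [List.idxOf_cons_ne _ (hne y hy), List.idxOf_cons_ne _ (hne x hx)]
      exact Nat.succ_le_succ (hfirst x hx)

/-- When `ℓ` is chosen, the remaining bakers are exactly those without an earlier feasible location,
and the choice maximizes how many of them are in range. -/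
theorem Concentrate.card_le {L' : Finset Loc} {B' : Finset Baker}
    {s s' : Baker → Option Loc} {order : List Loc} (h : G.Concentrate L' B' s order s')
    (hB : ∀ b ∈ B', G.feasible b ⊆ L') :
    ∀ ℓ ∈ L', ∀ ℓ', (B'.filter fun b => ℓ' ∈ G.feasible b ∧
        ∀ x ∈ G.feasible b, order.idxOf ℓ ≤ order.idxOf x).card ≤
      (B'.filter fun b => s' b = some ℓ).card := by
  induction h with
  | done => simp
  | step L' B' s a order s' mem most rest ih =>
    intro ℓ hℓ ℓ'
    by_cases hne : a = ℓ
    · subst hne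
      calc _ ≤ (G.inRange B' ℓ').card := by
            refine Finset.card_le_card fun b hb => ?_
            simp only [Finset.mem_filter, inRange] at hb ⊢
            exact ⟨hb.1, hb.2.1⟩
        _ ≤ (G.inRange B' a).card := by
            -- A location already removed is feasible for no remaining baker.
            by_cases h' : ℓ' ∈ L'
            · exact most ℓ' h'
            · rw [show G.inRange B' ℓ' = ∅ from Finset.filter_eq_empty_iff.2
                fun b hb h => h' (hB b hb h)]
              simp
        _ ≤ _ := by
            refine Finset.card_le_card fun b hb => Finset.mem_filter.2 ⟨?_, ?_⟩
            · exact (Finset.mem_filter.1 hb).1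
            · rw [rest.apply_of_notMem b (fun h => (Finset.mem_sdiff.1 h).2 hb), if_pos hb]
    · have h1 := ih (by
        intro c hc x hx
        obtain ⟨hc1, hc2⟩ := Finset.mem_sdiff.1 hc
        refine Finset.mem_erase.2 ⟨fun h => hc2 (Finset.mem_filter.2 ⟨hc1, h ▸ hx⟩), hB c hc1 hx⟩)
        ℓ (Finset.mem_erase.2 ⟨Ne.symm hne, hℓ⟩) ℓ'
      refine le_trans (Finset.card_le_card fun b hb => ?_)
        (h1.trans (Finset.card_le_card fun b hb => ?_))
      · obtain ⟨hb1, hb2, hb3⟩ := Finset.mem_filter.1 hb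
        have hab : a ∉ G.feasible b := by
          intro ha
          have := hb3 a ha
          rw [List.idxOf_cons_ne _ hne, List.idxOf_cons_self] at this
          omega
        refine Finset.mem_filter.2 ⟨Finset.mem_sdiff.2
          ⟨hb1, fun h => hab (Finset.mem_filter.1 h).2⟩, hb2, fun x hx => ?_⟩
        have := hb3 x hx
        rw [List.idxOf_cons_ne _ hne, List.idxOf_cons_ne _ (fun h : a = x => hab (h ▸ hx))] at this
        omega
      · obtain ⟨hb1, hb2⟩ := Finset.mem_filter.1 hb
        exact Finset.mem_filter.2 ⟨(Finset.mem_sdiff.1 hb1).1, hb2⟩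

theorem Concentrate.exists_isGreedy {s' : Baker → Option Loc} {order : List Loc}
    (h : G.Concentrate Finset.univ Finset.univ (fun _ => none) order s') :
    ∃ σ, s' = (fun b => some (σ b)) ∧ G.IsGreedy order.idxOf σ := by
  obtain ⟨hnodup, hmem⟩ := h.nodup_and_mem_iff
  have hB : ∀ b ∈ (Finset.univ : Finset Baker), G.feasible b ⊆ Finset.univ :=
    fun b _ => Finset.subset_univ _
  choose σ hσ using fun b => h.exists_first hB b (Finset.mem_univ b)
  have hs' : s' = fun b => some (σ b) := funext fun b => (hσ b).2.1
  refine ⟨σ, hs', ⟨?_, ?_, fun b => (hσ b).1, fun b => (hσ b).2.2, fun ℓ ℓ' => ?_⟩⟩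
  · intro x y hxy
    exact (List.idxOf_inj ((hmem x).2 (Finset.mem_univ x))).1 hxy
  · intro i hi
    have hlen : order.length = Fintype.card Loc := by
      rw [← List.toFinset_card_of_nodup hnodup, ← Finset.card_univ]
      congr 1
      ext x
      simp [hmem]
    exact ⟨order[i]'(hlen ▸ hi), hnodup.idxOf_getElem i _⟩
  · have := h.card_le hB ℓ (Finset.mem_univ ℓ) ℓ'
    rw [hs'] at this
    simp only [Option.some.injEq] at this
    refine le_trans (Finset.card_le_card fun b hb => ?_) this
    simp only [Finset.mem_filter, Finset.mem_univ, true_and] at hb ⊢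
    exact ⟨hb.1, fun x hx => hb.2.trans ((hσ b).2.2 x hx)⟩

theorem exists_concentrate (G : Game Loc Baker) (L' : Finset Loc) :
    ∀ (B' : Finset Baker) (s : Baker → Option Loc), ∃ order s', G.Concentrate L' B' s order s' := by
  induction L' using Finset.strongInduction with
  | H L' ih =>
    intro B' s
    rcases L'.eq_empty_or_nonempty with rfl | hne
    · exact ⟨[], s, .done B' s⟩
    · obtain ⟨ℓ, hℓ, hmost⟩ := L'.exists_max_image (fun ℓ => (G.inRange B' ℓ).card) hne
      obtain ⟨order, s', h⟩ := ih _ (Finset.erase_ssubset hℓ) (B' \ G.inRange B' ℓ)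
        (fun b => if b ∈ G.inRange B' ℓ then some ℓ else s b)
      exact ⟨ℓ :: order, s', .step L' B' s ℓ order s' hℓ hmost h⟩

theorem IsGreedy.load_anti {rank : Loc → ℕ} {σ : Baker → Loc} (h : G.IsGreedy rank σ)
    {ℓ ℓ' : Loc} (hle : rank ℓ ≤ rank ℓ') : load σ ℓ' ≤ load σ ℓ := by
  refine le_trans (Finset.card_le_card fun b hb => ?_) (h.most ℓ ℓ')
  simp only [Finset.mem_filter, Finset.mem_univ, true_and] at hb ⊢
  subst hb
  exact ⟨h.mem b, hle⟩

end Game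

/-! ### The second loop -/

/-- The millers are distributed over the locations in proportion to the bakers, up to rounding,
and favouring locations of small rank. -/
structure IsApportioned (rank : Loc → ℕ) (B M : Loc → ℕ) : Prop where
  mul_le : ∀ ℓ ℓ', B ℓ' * M ℓ ≤ B ℓ * (M ℓ' + 1)
  anti : ∀ ℓ ℓ', rank ℓ ≤ rank ℓ' → M ℓ' ≤ M ℓ

theorem arrivalUtility_le_iff {s : Baker → Option Loc} {t : Miller → Option Loc} {x y : Loc} :
    arrivalUtility s t x ≤ arrivalUtility s t y ↔
      load s (some x) * (load t (some y) + 1) ≤ load s (some y) * (load t (some x) + 1) := by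
  rw [arrivalUtility, arrivalUtility, div_le_div_iff₀ (by positivity) (by positivity)]
  exact_mod_cast Iff.rfl

/-- Both properties are loop invariants: the choice of a best location preserves `mul_le`, and the
tie-breaking preserves `anti`. -/
theorem InsertMillers.isApportioned [DecidableEq Miller] {order : List Loc}
    {s : Baker → Option Loc} {ms : List Miller} {t t' : Miller → Option Loc}
    (hinj : Function.Injective order.idxOf)
    (hanti : ∀ ℓ ℓ', order.idxOf ℓ ≤ order.idxOf ℓ' → load s (some ℓ') ≤ load s (some ℓ))
    (h : InsertMillers order s ms t t') (hms : ms.Nodup) (ht : ∀ m ∈ ms, t m = none)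
    (hap : IsApportioned order.idxOf (fun ℓ => load s (some ℓ)) fun ℓ => load t (some ℓ)) :
    IsApportioned order.idxOf (fun ℓ => load s (some ℓ)) fun ℓ => load t' (some ℓ) := by
  induction h with
  | done => exact hap
  | step m ms t t' a best first rest ih =>
    obtain ⟨hm, hms'⟩ := List.nodup_cons.1 hms
    refine ih hms' (fun m' hm' => ?_) ?_
    · rw [Function.update_of_ne (fun h : m' = m => hm (h ▸ hm')), ht m' (List.mem_cons_of_mem _ hm')]
    have hupd : ∀ x, load (Function.update t m (some a)) (some x) =
        load t (some x) + if x = a then 1 else 0 := by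
      intro x
      have := load_update t m (some a) (some x)
      simpa [ht m List.mem_cons_self] using this
    simp only [arrivalUtility_le_iff] at best
    refine ⟨fun ℓ ℓ' => ?_, fun ℓ ℓ' hle => ?_⟩
    · simp only [hupd]
      by_cases hℓ : ℓ = a
      · subst hℓ
        rw [if_pos rfl]
        exact (best ℓ').trans (Nat.mul_le_mul_left _ (by omega))
      · rw [if_neg hℓ]
        exact (hap.mul_le ℓ ℓ').trans (Nat.mul_le_mul_left _ (by omega))
    · simp only [hupd]
      have h0 := hap.anti ℓ ℓ' hle
      by_cases hℓ' : ℓ' = a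
      · subst hℓ'
        by_cases hℓ : ℓ = ℓ'
        · rw [hℓ]
        · rw [if_pos rfl, if_neg hℓ]
          -- The order could break only if `ℓ'` overtakes an earlier `ℓ` with equally many millers.
          -- As `ℓ` has at least as many bakers, it would tie with `ℓ'` and be preferred.
          by_contra! hlt
          have heq : load t (some ℓ') = load t (some ℓ) := by omega
          have hut : arrivalUtility s t ℓ = arrivalUtility s t ℓ' := by
            refine le_antisymm (arrivalUtility_le_iff.2 (best ℓ)) (arrivalUtility_le_iff.2 ?_)
            rw [heq]
            exact Nat.mul_le_mul_right _ (hanti _ _ hle)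
          exact hℓ (hinj (le_antisymm hle (first ℓ hut)))
      · rw [if_neg hℓ']
        omega

/-- The `isSome` clause is what later turns the final partial assignment into a genuine miller
profile. -/
theorem exists_insertMillers [DecidableEq Miller] [Nonempty Loc] (order : List Loc)
    (s : Baker → Option Loc) (ms : List Miller) :
    ∀ t : Miller → Option Loc, ∃ t', InsertMillers order s ms t t' ∧
      ∀ m, (m ∈ ms ∨ (t m).isSome) → (t' m).isSome := by
  induction ms with
  | nil => exact fun t => ⟨t, .done t, by simp⟩
  | cons m ms ih =>
    intro t
    obtain ⟨x, -, hx⟩ := Finset.univ.exists_max_image (arrivalUtility s t) Finset.univ_nonempty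
    obtain ⟨ℓ, hℓ, hfirst⟩ := (Finset.univ.filter fun ℓ =>
      arrivalUtility s t ℓ = arrivalUtility s t x).exists_min_image order.idxOf ⟨x, by simp⟩
    simp only [Finset.mem_filter, Finset.mem_univ, true_and, forall_const] at hℓ hfirst hx
    obtain ⟨t', h, hsome⟩ := ih (Function.update t m (some ℓ))
    refine ⟨t', .step m ms t t' ℓ (fun ℓ' => hℓ ▸ hx ℓ') (fun ℓ' h => hfirst ℓ' (h.trans hℓ)) h,
      fun m' hm' => hsome m' ?_⟩
    by_cases hmm : m' = m
    · simp [hmm]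
    · rw [Function.update_of_ne hmm]
      simpa [hmm] using hm'

theorem Game.exists_algorithmOutput [DecidableEq Miller] [Nonempty Loc] (G : Game Loc Baker) :
    ∃ (s : Baker → Loc) (t : Miller → Loc), G.AlgorithmOutput s t := by
  obtain ⟨order, s₀, h₀⟩ := G.exists_concentrate Finset.univ Finset.univ fun _ => none
  obtain ⟨t', ht', hsome⟩ := exists_insertMillers order s₀ (Finset.univ : Finset Miller).toList
    fun _ => none
  choose t ht using fun m => Option.isSome_iff_exists.1 (hsome m (Or.inl (by simp)))
  have htt : t' = fun m => some (t m) := funext ht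
  subst htt
  choose s₁ hs₁ using G.feasible_nonempty
  obtain ⟨s, hs, hmax⟩ := (Finset.univ.filter G.IsBakerProfile).exists_max_image (potential t)
    ⟨s₁, Finset.mem_filter.2 ⟨Finset.mem_univ _, hs₁⟩⟩
  simp only [Finset.mem_filter, Finset.mem_univ, true_and] at hs hmax
  exact ⟨s, t, order, s₀, _, h₀, Finset.nodup_toList _, by simp, ht', hs, hmax⟩

/-- Take for `p / q` the smallest number of bakers per miller over the occupied locations. -/
theorem IsApportioned.exists_ratio {rank B M : Loc → ℕ} (h : IsApportioned rank B M)
    (hM : ∃ ℓ, 0 < M ℓ) : ∃ p q : ℕ, 0 < q ∧ ∀ ℓ, p * M ℓ ≤ q * B ℓ ∧ q * B ℓ ≤ p * (M ℓ + 1) := by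
  obtain ⟨x, hx⟩ := hM
  obtain ⟨a, ha, hmin⟩ := (Finset.univ.filter fun ℓ => 0 < M ℓ).exists_min_image
    (fun ℓ => (B ℓ : ℚ) / M ℓ) ⟨x, by simpa using hx⟩
  simp only [Finset.mem_filter, Finset.mem_univ, true_and] at ha hmin
  refine ⟨B a, M a, ha, fun ℓ => ⟨?_, ?_⟩⟩
  · rcases Nat.eq_zero_or_pos (M ℓ) with h0 | hpos
    · simp [h0]
    · have := hmin ℓ hpos
      rw [div_le_div_iff₀ (by exact_mod_cast ha) (by exact_mod_cast hpos)] at this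
      rw [mul_comm (M a)]
      exact_mod_cast this
  · rw [mul_comm (M a)]
    exact h.mul_le a ℓ

namespace Game

/-! ### The millers are in equilibrium -/

section Equilibrium

variable {G : Game Loc Baker} {rank : Loc → ℕ} {σ s : Baker → Loc} {t : Miller → Loc} {p q : ℕ}

/-- If `ℓ` is overcrowded with bakers, maximality makes the locations reachable from it at least as
crowded as under `σ`; but `σ` keeps all these bakers within the reachable set. -/
theorem IsGreedy.mul_load_le (hσ : G.IsGreedy rank σ)
    (hanti : ∀ ℓ ℓ', rank ℓ ≤ rank ℓ' → load t ℓ' ≤ load t ℓ)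
    (hratio : ∀ ℓ, q * load σ ℓ ≤ p * (load t ℓ + 1)) (hs : G.IsBakerProfile s)
    (hmax : ∀ s', G.IsBakerProfile s' → potential t s' ≤ potential t s) (ℓ : Loc) :
    q * load s ℓ ≤ p * (load t ℓ + 1) := by
  classical
  by_contra! hlt
  have hpos : 0 < load s ℓ := by
    rcases Nat.eq_zero_or_pos (load s ℓ) with h0 | h0
    · simp [h0] at hlt
    · exact h0
  have hex : ∀ x, G.Reaches s ℓ x → load t x * load s ℓ ≤ load t ℓ * (load s x + 1) :=
    fun x hx => hx.load_mul_load_le hs hmax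
  have hclosed : ∀ b, G.Reaches s ℓ (s b) → ∀ x ∈ G.feasible b, G.Reaches s ℓ x :=
    fun b hb x hx => hb.tail ⟨b, rfl, hx⟩
  -- Without millers at `ℓ` the exchange inequality only shows that no reachable location has
  -- millers. The greedy choice then decides: all bakers at `ℓ` were still available when the
  -- earliest reachable location `a` was chosen.
  rcases Nat.eq_zero_or_pos (load t ℓ) with h0 | htpos
  · obtain ⟨a, ha, hmin⟩ := (Finset.univ.filter fun x => G.Reaches s ℓ x).exists_min_image rank
      ⟨ℓ, Finset.mem_filter.2 ⟨Finset.mem_univ ℓ, Relation.ReflTransGen.refl⟩⟩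
    simp only [Finset.mem_filter, Finset.mem_univ, true_and] at ha hmin
    have hta : load t a = 0 := by
      have := hex a ha
      rw [h0, zero_mul] at this
      rcases Nat.mul_eq_zero.1 (Nat.le_zero.1 this) with h | h <;> omega
    have hle : load s ℓ ≤ load σ a := by
      refine le_trans (Finset.card_le_card fun b hb => ?_) (hσ.most a ℓ)
      simp only [Finset.mem_filter, Finset.mem_univ, true_and] at hb ⊢
      subst hb
      exact ⟨hs b, hmin _ (hclosed b Relation.ReflTransGen.refl _ (hσ.mem b))⟩
    have h1 := hratio a
    have h2 := Nat.mul_le_mul_left q hle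
    rw [hta] at h1
    rw [h0] at hlt
    omega
  -- `σ` keeps the bakers of `A` in `A`, since a baker's first feasible location has at least as
  -- many millers as her location in `s`. Yet `s` has at least the load of `σ` everywhere on `A`,
  -- and more at `ℓ`.
  · let A := Finset.univ.filter fun x => G.Reaches s ℓ x ∧ load t ℓ ≤ load t x
    have hsum : ∑ x ∈ A, load s x ≤ ∑ x ∈ A, load σ x := by
      refine sum_load_le s σ A fun b hb => ?_
      simp only [A, Finset.mem_filter, Finset.mem_univ, true_and] at hb ⊢
      exact ⟨hclosed b hb.1 _ (hσ.mem b), hb.2.trans (hanti _ _ (hσ.le b _ (hs b)))⟩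
    refine absurd hsum (not_le.2 (Finset.sum_lt_sum (fun x hx => ?_) ⟨ℓ, ?_, ?_⟩))
    · simp only [A, Finset.mem_filter, Finset.mem_univ, true_and] at hx
      by_contra! hlt'
      have h1 := hex x hx.1
      have h2 := hratio x
      have h3 : load s x + 1 ≤ load σ x := hlt'
      have h4 : q * (load s x + 1) ≤ p * (load t x + 1) := (Nat.mul_le_mul_left q h3).trans h2
      have h5 := hx.2
      have h6 : load t x * (p * (load t ℓ + 1)) < load t x * (q * load s ℓ) :=
        Nat.mul_lt_mul_of_pos_left hlt (by omega)
      have h7 := Nat.mul_le_mul_left q h1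
      have h8 := Nat.mul_le_mul_left (load t ℓ) h4
      have h9 := Nat.mul_le_mul_left p h5
      nlinarith
    · exact Finset.mem_filter.2 ⟨Finset.mem_univ ℓ, Relation.ReflTransGen.refl, le_rfl⟩
    · exact lt_of_mul_lt_mul_left ((hratio ℓ).trans_lt hlt) (Nat.zero_le q)

/-- The mirror argument: a deficit at `ℓ` propagates backwards to the locations that reach `ℓ` and
have no more millers, and every baker whom `σ` puts into this set is also there under `s`. -/
theorem IsGreedy.le_mul_load (hσ : G.IsGreedy rank σ) (hq : 0 < q)
    (hanti : ∀ ℓ ℓ', rank ℓ ≤ rank ℓ' → load t ℓ' ≤ load t ℓ)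
    (hratio : ∀ ℓ, p * load t ℓ ≤ q * load σ ℓ) (hs : G.IsBakerProfile s)
    (hmax : ∀ s', G.IsBakerProfile s' → potential t s' ≤ potential t s) (ℓ : Loc) :
    p * load t ℓ ≤ q * load s ℓ := by
  classical
  by_contra! hlt
  have htpos : 0 < load t ℓ := by
    rcases Nat.eq_zero_or_pos (load t ℓ) with h0 | h0
    · simp [h0] at hlt
    · exact h0
  have hex : ∀ x, G.Reaches s x ℓ → load t ℓ * load s x ≤ load t x * (load s ℓ + 1) :=
    fun x hx => hx.load_mul_load_le hs hmax
  let A := Finset.univ.filter fun x => G.Reaches s x ℓ ∧ load t x ≤ load t ℓ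
  have hsum : ∑ x ∈ A, load σ x ≤ ∑ x ∈ A, load s x := by
    refine sum_load_le σ s A fun b hb => ?_
    simp only [A, Finset.mem_filter, Finset.mem_univ, true_and] at hb ⊢
    exact ⟨hb.1.head ⟨b, rfl, hσ.mem b⟩, (hanti _ _ (hσ.le b _ (hs b))).trans hb.2⟩
  refine absurd hsum (not_le.2 (Finset.sum_lt_sum (fun x hx => ?_) ⟨ℓ, ?_, ?_⟩))
  · simp only [A, Finset.mem_filter, Finset.mem_univ, true_and] at hx
    by_contra! hlt'
    have h1 := hex x hx.1
    have h2 : q * (load σ x + 1) ≤ q * load s x := Nat.mul_le_mul_left q hlt'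
    have h3 := hratio x
    have h5 := hx.2
    have h6 := Nat.mul_le_mul_left q h1
    have h7 : load t ℓ * (p * load t x + q) ≤ load t ℓ * (q * load s x) :=
      Nat.mul_le_mul_left _ (by linarith)
    have h8 := Nat.mul_le_mul_left (load t x) hlt.le
    have h9 := Nat.mul_le_mul_left q h5
    rcases Nat.eq_zero_or_pos (load t x) with h0 | h0
    · rw [h0] at h7 h6
      nlinarith [Nat.mul_pos htpos hq]
    · have h10 := Nat.mul_lt_mul_of_pos_left hlt h0
      nlinarith
  · exact Finset.mem_filter.2 ⟨Finset.mem_univ ℓ, Relation.ReflTransGen.refl, le_rfl⟩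
  · exact lt_of_mul_lt_mul_left (hlt.trans_le (hratio ℓ)) (Nat.zero_le q)

end Equilibrium

end Game

theorem isMillerEquilibrium_of_ratio [DecidableEq Miller] {s : Baker → Loc}
    {t : Miller → Loc} {p q : ℕ} (hq : 0 < q)
    (h : ∀ ℓ, p * load t ℓ ≤ q * load s ℓ ∧ q * load s ℓ ≤ p * (load t ℓ + 1)) :
    IsMillerEquilibrium s t := by
  rintro m ⟨ℓ, hlt⟩
  by_cases hm : ℓ = t m
  · subst hm
    simp at hlt
  refine absurd hlt (not_lt.2 ?_)
  have h3 := load_update t m ℓ ℓ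
  simp only [if_neg hm, if_true, add_zero] at h3
  have h4 : (0 : ℚ) < load t (t m) := by exact_mod_cast load_pos_apply t m
  have h5 : (0 : ℚ) < q := by exact_mod_cast hq
  rw [millerUtility, millerUtility, Function.update_self, h3]
  calc (load s ℓ : ℚ) / ((load t ℓ + 1 : ℕ) : ℚ) ≤ p / q := by
        rw [div_le_div_iff₀ (by positivity) h5, mul_comm]
        exact_mod_cast (h ℓ).2
    _ ≤ _ := by
        rw [div_le_div_iff₀ h5 h4, mul_comm (load s (t m) : ℚ)]
        exact_mod_cast (h (t m)).1

namespace Game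

/-! ### The coverage -/

section Coverage

variable {G : Game Loc Baker} {rank : Loc → ℕ} {σ s : Baker → Loc} {t : Miller → Loc} {p q : ℕ}

/-- A baker at a location without millers would raise the potential by moving to one with millers,
so `s` covers each baker who can be covered at all. -/
theorem card_covered_le_coverage [DecidableEq Miller] (hs : G.IsBakerProfile s)
    (hmax : ∀ s', G.IsBakerProfile s' → potential t s' ≤ potential t s)
    (hσ : G.IsBakerProfile σ) :
    (Finset.univ.filter fun b => 0 < load t (σ b)).card ≤ coverage s t := by
  refine Finset.card_le_card fun b hb => ?_
  simp only [Finset.mem_filter, Finset.mem_univ, true_and] at hb ⊢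
  have h1 : G.Reaches s (s b) (σ b) := Relation.ReflTransGen.single ⟨b, rfl, hσ b⟩
  have h2 := h1.load_mul_load_le hs hmax
  have h3 := Nat.mul_pos hb (load_pos_apply s b)
  exact Nat.pos_of_mul_pos_right (h3.trans_le h2)

/-- The bakers at the first `r` locations, compared to those at the locations with millers. -/
theorem IsGreedy.mul_card_rank_lt_le (hσ : G.IsGreedy rank σ) (hq : 0 < q)
    (hanti : ∀ ℓ ℓ', rank ℓ ≤ rank ℓ' → load t ℓ' ≤ load t ℓ)
    (hratio : ∀ ℓ, p * load t ℓ ≤ q * load σ ℓ ∧ q * load σ ℓ ≤ p * (load t ℓ + 1))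
    [Nonempty Miller] (r : ℕ) :
    Fintype.card Miller * (Finset.univ.filter fun b => rank (σ b) < r).card ≤
      (Fintype.card Miller + (r - 1)) * (Finset.univ.filter fun b => 0 < load t (σ b)).card := by
  set k := Fintype.card Miller
  set C := (Finset.univ.filter fun b => rank (σ b) < r).card
  set W := (Finset.univ.filter fun b => 0 < load t (σ b)).card with hWdef
  have hpk : p * k ≤ q * W := by
    have hW : W = ∑ x ∈ Finset.univ.filter fun x => 0 < load t x, load σ x := by
      rw [sum_load]; simp [hWdef]
    have hk : k = ∑ x ∈ Finset.univ.filter fun x => 0 < load t x, load t x := by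
      rw [sum_load]
      simp only [Finset.mem_filter, Finset.mem_univ, true_and, load_pos_apply,
        Finset.filter_true, Finset.card_univ, k]
    rw [hW, hk, Finset.mul_sum, Finset.mul_sum]
    exact Finset.sum_le_sum fun x _ => (hratio x).1
  let U := Finset.univ.filter fun x => rank x < r ∧ load t x = 0
  have hU : U.card ≤ r - 1 := by
    rw [← Nat.card_Ico 1 r]
    refine Finset.card_le_card_of_injOn rank (fun x hx => ?_) hσ.injective.injOn
    simp only [U, Finset.coe_filter, Finset.mem_univ, true_and, Set.mem_ofPred_eq] at hx
    rw [Finset.coe_Ico, Set.mem_Ico]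
    -- The location of rank `0` has the most millers, hence at least one; this accounts for `r - 1`
    -- instead of `r`.
    refine ⟨Nat.pos_of_ne_zero fun h0 => ?_, hx.1⟩
    obtain ⟨m⟩ := ‹Nonempty Miller›
    have h1 := hanti x (t m) (by omega)
    have h2 := load_pos_apply t m
    omega
  have hCU : C ≤ W + ∑ x ∈ U, load σ x := by
    rw [sum_load]
    refine le_trans (Finset.card_le_card fun b hb => ?_) (Finset.card_union_le _ _)
    simp only [U, Finset.mem_filter, Finset.mem_univ, true_and, Finset.mem_union] at hb ⊢
    omega
  have hUp : q * ∑ x ∈ U, load σ x ≤ (r - 1) * p := by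
    calc q * ∑ x ∈ U, load σ x = ∑ x ∈ U, q * load σ x := Finset.mul_sum _ _ _
      _ ≤ ∑ x ∈ U, p := Finset.sum_le_sum fun x hx => by
          have h1 := (hratio x).2
          rw [(Finset.mem_filter.1 hx).2.2] at h1
          simpa using h1
      _ = U.card * p := by simp
      _ ≤ _ := Nat.mul_le_mul_right _ hU
  refine le_of_mul_le_mul_left (a := q) ?_ hq
  calc q * (k * C) ≤ q * (k * (W + ∑ x ∈ U, load σ x)) := by gcongr
    _ = k * (q * W) + k * (q * ∑ x ∈ U, load σ x) := by ring
    _ ≤ k * (q * W) + k * ((r - 1) * p) := by gcongr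
    _ = k * (q * W) + (r - 1) * (p * k) := by ring
    _ ≤ k * (q * W) + (r - 1) * (q * W) := by gcongr
    _ = q * ((k + (r - 1)) * W) := by ring

/-- One step of the greedy algorithm for maximum coverage. -/
theorem IsGreedy.coverage_le_add [DecidableEq Miller] (hσ : G.IsGreedy rank σ)
    (hs : G.IsBakerProfile s) (t : Miller → Loc) {i : ℕ} (hi : i < Fintype.card Loc) :
    coverage s t + min (Fintype.card Loc) (Fintype.card Miller) *
        (Finset.univ.filter fun b => rank (σ b) < i).card ≤
      (Finset.univ.filter fun b => rank (σ b) < i).card +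
        min (Fintype.card Loc) (Fintype.card Miller) *
          (Finset.univ.filter fun b => rank (σ b) < i + 1).card := by
  obtain ⟨a, ha⟩ := hσ.exists_rank_eq i hi
  set r := min (Fintype.card Loc) (Fintype.card Miller)
  have hK : (Finset.univ.image t).card ≤ r :=
    le_min (Finset.card_le_univ _) Finset.card_image_le
  have hsucc : (Finset.univ.filter fun b => rank (σ b) < i + 1).card =
      (Finset.univ.filter fun b => rank (σ b) < i).card + load σ a := by
    rw [load, ← Finset.card_union_of_disjoint]
    · congr 1
      ext b
      simp only [Finset.mem_filter, Finset.mem_univ, true_and, Finset.mem_union, ← ha,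
        ← hσ.injective.eq_iff (a := σ b)]
      omega
    · refine Finset.disjoint_filter.2 fun b _ hb h => ?_
      rw [h, ha] at hb
      omega
  -- At most `r` locations have millers under `t`, and each accounts for at most `load σ a` bakers
  -- not yet taken by the first `i` greedy locations.
  have hcov : coverage s t ≤ (Finset.univ.filter fun b => rank (σ b) < i).card +
      r * load σ a := by
    calc coverage s t ≤ ((Finset.univ.filter fun b => rank (σ b) < i) ∪
          (Finset.univ.image t).biUnion fun x => Finset.univ.filter fun b =>
            x ∈ G.feasible b ∧ rank a ≤ rank (σ b)).card := by
          refine Finset.card_le_card fun b hb => ?_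
          simp only [Finset.mem_filter, Finset.mem_univ, true_and, Finset.mem_union,
            Finset.mem_biUnion, Finset.mem_image, exists_exists_eq_and] at hb ⊢
          obtain ⟨m, hm⟩ := Finset.card_pos.1 hb
          rcases lt_or_ge (rank (σ b)) i with h | h
          · exact Or.inl h
          · exact Or.inr ⟨m, (Finset.mem_filter.1 hm).2 ▸ hs b, ha ▸ h⟩
      _ ≤ _ := Finset.card_union_le _ _
      _ ≤ _ := by
          gcongr
          refine (Finset.card_biUnion_le_card_mul _ _ (load σ a) fun x _ => hσ.most a x).trans ?_
          gcongr
  rw [hsucc, mul_add]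
  omega

/-- Each greedy step closes at least a fraction `1 / r` of the gap to the compared coverage, and `(1
- 1/r) ^ r ≤ exp (-1)`. -/
theorem IsGreedy.one_sub_inv_mul_coverage_le [DecidableEq Miller] [Nonempty Loc] [Nonempty Miller]
    (hσ : G.IsGreedy rank σ) (hs : G.IsBakerProfile s) (t : Miller → Loc) :
    (1 - Real.exp (-1)) * (coverage s t : ℝ) ≤
      (Finset.univ.filter fun b =>
        rank (σ b) < min (Fintype.card Loc) (Fintype.card Miller)).card := by
  set r := min (Fintype.card Loc) (Fintype.card Miller) with hr
  have hr1 : 1 ≤ r := le_min Fintype.card_pos Fintype.card_pos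
  have hr1' : (1 : ℝ) ≤ r := by exact_mod_cast hr1
  set N : ℝ := (coverage s t : ℝ) with hN
  set c : ℕ → ℝ := fun i => ((Finset.univ.filter fun b => rank (σ b) < i).card : ℝ) with hc
  have hstep : ∀ i ≤ r, N - c i ≤ (1 - 1 / (r : ℝ)) ^ i * N := by
    intro i
    induction i with
    | zero => intro _; simp [hc]
    | succ i ih =>
      intro hi
      have h1 := hσ.coverage_le_add hs t (i := i) (lt_of_lt_of_le hi (min_le_left _ _))
      have h2 : N + r * c i ≤ c i + r * c (i + 1) := by
        simp only [hN, hc]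
        exact_mod_cast h1
      have h3 := ih (by omega)
      have h4 : 0 ≤ 1 - 1 / (r : ℝ) := by
        rw [sub_nonneg, div_le_one (by linarith)]; exact hr1'
      have h5 : N - c (i + 1) ≤ (1 - 1 / (r : ℝ)) * (N - c i) := by
        have h6 : (N - c i) / r ≤ c (i + 1) - c i := by
          rw [div_le_iff₀ (by linarith)]
          linarith
        have h7 : (1 - 1 / (r : ℝ)) * (N - c i) = N - c i - (N - c i) / r := by ring
        rw [h7]
        linarith
      calc _ ≤ _ := h5
        _ ≤ (1 - 1 / (r : ℝ)) * ((1 - 1 / (r : ℝ)) ^ i * N) := by gcongr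
        _ = _ := by ring
  have h1 := hstep r le_rfl
  have h2 := Real.one_sub_div_pow_le_exp_neg hr1'
  have h3 : (1 - 1 / (r : ℝ)) ^ r * N ≤ Real.exp (-1) * N :=
    mul_le_mul_of_nonneg_right h2 (Nat.cast_nonneg _)
  have h4 : N - c r ≤ Real.exp (-1) * N := h1.trans h3
  change (1 - Real.exp (-1)) * N ≤ c r
  linarith

end Coverage

theorem AlgorithmOutput.exists_isGreedy [DecidableEq Miller] [Nonempty Miller]
    {G : Game Loc Baker} {s : Baker → Loc} {t : Miller → Loc} (h : G.AlgorithmOutput s t) :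
    ∃ (rank : Loc → ℕ) (σ : Baker → Loc) (p q : ℕ), G.IsGreedy rank σ ∧ 0 < q ∧
      (∀ ℓ ℓ', rank ℓ ≤ rank ℓ' → load t ℓ' ≤ load t ℓ) ∧
      ∀ ℓ, p * load t ℓ ≤ q * load σ ℓ ∧ q * load σ ℓ ≤ p * (load t ℓ + 1) := by
  obtain ⟨order, s₀, millers, hconc, hnodup, -, hins, -, -⟩ := h
  obtain ⟨σ, rfl, hσ⟩ := hconc.exists_isGreedy
  have hap := hins.isApportioned hσ.injective
    (fun ℓ ℓ' hle => by simpa only [load_some_comp] using hσ.load_anti hle) hnodup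
    (fun _ _ => rfl) ⟨fun ℓ ℓ' => ?_, fun ℓ ℓ' hle => ?_⟩
  · simp only [load_some_comp] at hap
    obtain ⟨m⟩ := ‹Nonempty Miller›
    obtain ⟨p, q, hq, hratio⟩ := hap.exists_ratio ⟨t m, load_pos_apply t m⟩
    exact ⟨_, σ, p, q, hσ, hq, hap.anti, hratio⟩
  · simp [load]
  · simp [load]

end Game

end

end BakersMillers

/-- Every run of the algorithm yields a pure Nash equilibrium that approximates the optimal
coverage by the stated factor (and the algorithm does yield an output). -/
theorem mainTheorem4 {Loc Baker Miller : Type*} [Fintype Loc] [DecidableEq Loc]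
    [Fintype Baker] [DecidableEq Baker] [Fintype Miller] [DecidableEq Miller]
    [Nonempty Loc] [Nonempty Miller] (G : BakersMillers.Game Loc Baker) :
    (∃ (s : Baker → Loc) (t : Miller → Loc), G.AlgorithmOutput s t) ∧
    ∀ (s : Baker → Loc) (t : Miller → Loc), G.AlgorithmOutput s t →
      G.IsPureNash s t ∧
      (G.optimalCoverage Miller : ℝ) ≤
        (1 + ((min (Fintype.card Loc) (Fintype.card Miller) : ℝ) - 1) / Fintype.card Miller)
          * (Real.exp 1 / (Real.exp 1 - 1)) * BakersMillers.coverage s t := by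
  refine ⟨G.exists_algorithmOutput, fun s t h => ?_⟩
  obtain ⟨rank, σ, p, q, hσ, hq, hanti, hratio⟩ := h.exists_isGreedy
  obtain ⟨-, -, -, -, -, -, -, hs, hmax⟩ := h
  refine ⟨⟨hs, BakersMillers.Game.isBakerEquilibrium_of_potential_le hs hmax,
    BakersMillers.isMillerEquilibrium_of_ratio hq fun ℓ =>
      ⟨hσ.le_mul_load hq hanti (fun x => (hratio x).1) hs hmax ℓ,
        hσ.mul_load_le hanti (fun x => (hratio x).2) hs hmax ℓ⟩⟩, ?_⟩
  have hne : (Finset.univ.filter fun p : (Baker → Loc) × (Miller → Loc) =>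
      G.IsBakerProfile p.1).Nonempty := ⟨(s, t), by simpa using hs⟩
  obtain ⟨⟨s', t'⟩, hmem, heq⟩ := Finset.exists_mem_eq_sup _ hne
    fun p : (Baker → Loc) × (Miller → Loc) => BakersMillers.coverage p.1 p.2
  have hs' : G.IsBakerProfile s' := (Finset.mem_filter.1 hmem).2
  rw [BakersMillers.Game.optimalCoverage, heq]
  have h1 := hσ.one_sub_inv_mul_coverage_le hs' t'
  have h2 := (hσ.mul_card_rank_lt_le hq hanti hratio
    (min (Fintype.card Loc) (Fintype.card Miller))).trans
    (Nat.mul_le_mul_left _ (BakersMillers.Game.card_covered_le_coverage hs hmax hσ.mem))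
  have hr : 1 ≤ min (Fintype.card Loc) (Fintype.card Miller) :=
    le_min Fintype.card_pos Fintype.card_pos
  rw [← Nat.cast_min]
  set r := min (Fintype.card Loc) (Fintype.card Miller)
  set C := (Finset.univ.filter fun b => rank (σ b) < r).card
  have h3 : (Fintype.card Miller : ℝ) * C ≤
      (Fintype.card Miller + ((r : ℝ) - 1)) * BakersMillers.coverage s t := by
    rw [← Nat.cast_one, ← Nat.cast_sub hr]
    exact_mod_cast h2
  have hk : (0 : ℝ) < Fintype.card Miller := by exact_mod_cast Fintype.card_pos
  have he : 1 < Real.exp 1 := Real.one_lt_exp_iff.2 one_pos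
  have h4 : (C : ℝ) ≤ (1 + ((r : ℝ) - 1) / Fintype.card Miller) * BakersMillers.coverage s t := by
    rw [← mul_le_mul_iff_right₀ hk]
    refine h3.trans_eq ?_
    field_simp
  have h5 : (BakersMillers.coverage s' t' : ℝ) ≤ Real.exp 1 / (Real.exp 1 - 1) * C := by
    rw [div_mul_eq_mul_div, le_div_iff₀ (by linarith)]
    have h6 := mul_le_mul_of_nonneg_left h1 (Real.exp_pos 1).le
    rw [← mul_assoc, mul_sub, ← Real.exp_add, mul_one, add_neg_cancel, Real.exp_zero] at h6
    linarith
  calc _ ≤ _ := h5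
    _ ≤ Real.exp 1 / (Real.exp 1 - 1) *
        ((1 + ((r : ℝ) - 1) / Fintype.card Miller) * BakersMillers.coverage s t) :=
      mul_le_mul_of_nonneg_left h4 (div_nonneg (by linarith) (by linarith))
    _ = _ := by ring
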